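/- Let $X$ be a finite connected graph, that is, a connected Hausdorff space with a cellular stratification consisting of finitely many cells, all of dimension at most $1$. Here a cellular stratification is a decomposition of $X$ into connected, locally closed strata $e_\lambda$, indexed by a poset in which $\lambda\le\mu$ if and only if $e_\lambda\subset\overline{e_\mu}$. Each stratum is equipped with a characteristic map $\varphi_\lambda:D_\lambda\to X$, where $\operatorname{Int}D^n\subset D_\lambda\subset D^n$ for $n=\dim e_\lambda$, which is a quotient map onto $\overline{e_\lambda}$ and restricts to a homeomorphism $\operatorname{Int}D^n\cong e_\lambda$; and $\overline{e_\lambda}\setminus e_\lambda$ is covered by finitely many cells of dimension less than $n$. Let $v(X)$ be the number of $0$-cells of $X$, let $k\ge 0$ be an integer, and let $\mathrm{Conf}_k(X)\subset X^k$ be the space of $k$-tuples of pairwise distinct points. Let $\pi^{\mathrm{comp}}_{k,X}$ be the stratification of $\mathrm{Conf}_k(X)$ in which two configurations $(x_i)$ and $(y_i)$ lie in the same stratum if and only if, for each $i$, the points $x_i$ and $y_i$ lie in the same cell of $X$ and, whenever $x_i,x_j$ lie in the same $1$-cell $e$, they appear in the same order as $y_i,y_j$ with respect to the coordinate of $e\cong(-1,1)$.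 If $e$ is a stratum contained in $e_{\lambda_1}\times\cdots\times e_{\lambda_k}$, let $E$ be its inverse image under $\varphi_{\lambda_1}\times\cdots\times\varphi_{\lambda_k}$ in the product of the open disks. The domain $D_e$ of $e$ is the set of all points of the closure of $E$ in $D_{\lambda_1}\times\cdots\times D_{\lambda_k}$ which $\varphi_{\lambda_1}\times\cdots\times\varphi_{\lambda_k}$ maps into $\mathrm{Conf}_k(X)$, and the characteristic map $\varphi_e:D_e\to\mathrm{Conf}_k(X)$ is the restriction of this product. Let $C(\pi^{\mathrm{comp}}_{k,X})$ be the face category: its objects are the (non-empty) strata of $\pi^{\mathrm{comp}}_{k,X}$, its morphisms $e\to e'$ are the continuous maps $b:D_e\to D_{e'}$ with $\varphi_{e'}\circ b=\varphi_e$, and composition is composition of maps. Let $C^{\mathrm{comp}}_k(X)=BC(\pi^{\mathrm{comp}}_{k,X})$ be its classifying space, i.e. the geometric realization of its nerve, with its standard cell structure, whose $n$-cells are the images of the interior of the standard $n$-simplex under the characteristic maps of the nondegenerate $n$-simplices of the nerve. Then \[ \dim C^{\mathrm{comp}}_k(X)\le\min\{k,v(X)\}. \] -/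

import Mathlib

open CategoryTheory Topology

/-! ### Cellular stratified spaces -/

/-- A cellular stratification, indexed by its face poset `P`, on a (Hausdorff) space `X`:
a stratification `strat : X → P` together with an `n`-cell structure on every stratum. -/
structure CellularStratification (X : Type*) [TopologicalSpace X] (P : Type*) [PartialOrder P] where
  /-- the stratification -/
  strat : X → P
  surjective : Function.Surjective strat
  le_iff : ∀ l m : P, l ≤ m ↔ strat ⁻¹' {l} ⊆ closure (strat ⁻¹' {m})
  isConnected : ∀ l : P, IsConnected (strat ⁻¹' {l})
  isLocallyClosed : ∀ l : P, IsLocallyClosed (strat ⁻¹' {l})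
  /-- the dimension of a cell -/
  dim : P → ℕ
  /-- the domain of the characteristic map of a cell: a subspace of the closed unit disk which
  contains the open unit disk -/
  domain : ∀ l : P, Set (EuclideanSpace ℝ (Fin (dim l)))
  ball_subset : ∀ l : P, Metric.ball 0 1 ⊆ domain l
  domain_subset : ∀ l : P, domain l ⊆ Metric.closedBall 0 1
  /-- the characteristic map of a cell -/
  char : ∀ l : P, C(domain l, X)
  /-- the characteristic map is a quotient map onto the closure of the cell -/
  range_char : ∀ l : P, Set.range (char l) = closure (strat ⁻¹' {l})
  isQuotientMap_char : ∀ l : P, IsQuotientMap (Set.rangeFactorization (char l))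
  /-- the characteristic map restricts to a homeomorphism from the open disk onto the cell -/
  image_ball : ∀ l : P, char l '' {d | d.1 ∈ Metric.ball 0 1} = strat ⁻¹' {l}
  isEmbedding_ball : ∀ l : P,
    IsEmbedding (Set.domRestrict {d : domain l | d.1 ∈ Metric.ball 0 1} (char l))
  /-- the boundary of a cell is covered by finitely many cells of lower dimension -/
  boundary : ∀ l : P, ∃ F : Set P, F.Finite ∧ (∀ m ∈ F, dim m < dim l) ∧
    closure (strat ⁻¹' {l}) \ strat ⁻¹' {l} ⊆ ⋃ m ∈ F, strat ⁻¹' {m}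

namespace CellularStratification

variable {X : Type*} [TopologicalSpace X] {P : Type*} [PartialOrder P]

/-- A graph: all the cells have dimension at most one. -/
def IsGraph (S : CellularStratification X P) : Prop := ∀ l, S.dim l ≤ 1

/-- `v(X)`: the number of `0`-cells. -/
noncomputable def numVertices (S : CellularStratification X P) : ℕ :=
  Nat.card {l : P // S.dim l = 0}

theorem exists_coord (S : CellularStratification X P) (x : X) :
    ∃ d : S.domain (S.strat x), d.1 ∈ Metric.ball 0 1 ∧ S.char (S.strat x) d = x := by
  have h : x ∈ S.char (S.strat x) '' {d | d.1 ∈ Metric.ball 0 1} := by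
    rw [S.image_ball]; rfl
  exact h

/-- The coordinate of `x` in its own cell: the point of the open disk which the characteristic map
of that cell sends to `x`. -/
noncomputable def coord (S : CellularStratification X P) (x : X) : S.domain (S.strat x) :=
  (S.exists_coord x).choose

theorem coord_spec (S : CellularStratification X P) (x : X) :
    (S.coord x).1 ∈ Metric.ball 0 1 ∧ S.char (S.strat x) (S.coord x) = x :=
  (S.exists_coord x).choose_spec

/-- The position of a point in its cell as a real number. If the cell has dimension one, this is
its coordinate in the open interval `(-1, 1)`; if the cell has dimension zero, it is `0`. -/
noncomputable def position (S : CellularStratification X P) (x : X) : ℝ := ∑ i, (S.coord x).1 i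

end CellularStratification

/-! ### Face categories -/

/-- A family of characteristic maps `char i : Dom i → Y`. -/
structure CellFamily (Y : Type*) [TopologicalSpace Y] (I : Type*) where
  /-- the domain of a cell -/
  Dom : I → Type
  /-- the topology of a domain -/
  top : ∀ i, TopologicalSpace (Dom i)
  /-- the characteristic map of a cell -/
  char : ∀ i, C(Dom i, Y)

attribute [instance] CellFamily.top

/-- The objects of the face category: the cells. -/
structure FaceCat {Y I : Type*} [TopologicalSpace Y] (F : CellFamily Y I) where
  /-- the index of the cell -/
  cell : I

/-- The face category: a morphism from a cell to another one is a lift of the characteristic map of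
the first along the characteristic map of the second, and composition is composition of maps. -/
instance FaceCat.category {Y I : Type*} [TopologicalSpace Y] (F : CellFamily Y I) :
    Category.{0} (FaceCat F) where
  Hom i j := {b : C(F.Dom i.cell, F.Dom j.cell) // (F.char j.cell).comp b = F.char i.cell}
  id i := ⟨ContinuousMap.id _, ContinuousMap.comp_id _⟩
  comp b c := ⟨c.1.comp b.1, by rw [← ContinuousMap.comp_assoc, c.2, b.2]⟩

/-! ### The stratification of the configuration space of a graph -/

/-- The configuration space of `k` distinct ordered points, with the subspace topology of `X^k`. -/
abbrev Conf (k : ℕ) (X : Type*) : Type _ := {x : Fin k → X // Function.Injective x}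

namespace CellularStratification

variable {X : Type*} [TopologicalSpace X] {P : Type*} [PartialOrder P]

open Classical in
/-- The stratification of `Conf k X` which refines the product stratification of `X^k` by the braid
arrangement: besides the cell of each point, it records the order of any two points that lie in
the same cell (and `0` for two points in different cells). -/
noncomputable def confStrat (S : CellularStratification X P) (k : ℕ) (x : Conf k X) :
    (Fin k → P) × (Fin k → Fin k → SignType) :=
  (fun i => S.strat (x.1 i), fun i j =>
    if S.strat (x.1 i) = S.strat (x.1 j) then
      SignType.sign (S.position (x.1 i) - S.position (x.1 j)) else 0)

/-- The cells of `Conf k X`: the indices of the non-empty strata. -/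
abbrev ConfCell (S : CellularStratification X P) (k : ℕ) : Type _ := Set.range (S.confStrat k)

/-- The product of the characteristic maps of the cells `c i` of `X`. -/
def prodChar (S : CellularStratification X P) {k : ℕ} (c : Fin k → P)
    (d : ∀ i, S.domain (c i)) : Fin k → X := fun i => S.char (c i) (d i)

/-- The open cell of the subdivision of the product of domains: the points of the product of the
open disks which the product of the characteristic maps sends to the stratum `p` of `Conf k X`. -/
def confInterior (S : CellularStratification X P) {k : ℕ} (p : S.ConfCell k) :
    Set (∀ i, S.domain (p.1.1 i)) :=
  {d | (∀ i, (d i).1 ∈ Metric.ball 0 1) ∧ ∃ x : Conf k X, x.1 = S.prodChar p.1.1 d ∧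
    S.confStrat k x = p.1}

/-- The domain of the cell `p` of `Conf k X`: the closure of the open cell in the product of the
domains, without the points which the product of the characteristic maps sends to the
discriminant. -/
def confDomain (S : CellularStratification X P) {k : ℕ} (p : S.ConfCell k) :
    Set (∀ i, S.domain (p.1.1 i)) :=
  {d | d ∈ closure (S.confInterior p) ∧ Function.Injective (S.prodChar p.1.1 d)}

/-- The cells of `Conf k X` with their characteristic maps, the restrictions of products of
characteristic maps of `X`. -/
def confFamily (S : CellularStratification X P) (k : ℕ) : CellFamily (Conf k X) (S.ConfCell k) where
  Dom p := S.confDomain p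
  top _ := inferInstance
  char p :=
    { toFun := fun d => ⟨S.prodChar p.1.1 d.1, d.2.2⟩
      continuous_toFun := Continuous.subtype_mk (continuous_pi fun i =>
        (S.char (p.1.1 i)).continuous.comp ((continuous_apply i).comp continuous_subtype_val)) _ }

end CellularStratification

/-! ### The classifying space and its dimension -/

open scoped Simplicial in
/-- The characteristic map of a simplex in the geometric realization of a simplicial set. -/
noncomputable def realizationChar (K : SSet) {n : ℕ} (s : K _⦋n⦌) (t : stdSimplex ℝ (Fin (n + 1))) :
    SSet.toTop.obj K :=
  SSet.toTop.map (SSet.yonedaEquiv.symm s) ((SimplexCategory.toTopHomeo ⦋n⦌).symm t)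

/-- The set of open `n`-cells of the geometric realization `|K|`: the images of the interior of
the standard `n`-simplex under the characteristic maps of the nondegenerate `n`-simplices. -/
def realizationCells (K : SSet) (n : ℕ) : Set (Set (SSet.toTop.obj K)) :=
  {e | ∃ s ∈ K.nonDegenerate n, e = realizationChar K s '' {t | ∀ i, 0 < t.1 i}}

/-- The dimension of the cell complex `|K|`: the supremum of the dimensions of its cells
(`⊥` if it is empty). -/
noncomputable def realizationDim (K : SSet) : WithBot ℕ∞ :=
  ⨆ n ∈ {n : ℕ | (realizationCells K n).Nonempty}, ((n : ℕ∞) : WithBot ℕ∞)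

/-- The dimension of the classifying space `BC = |N(C)|` of a small category. -/
noncomputable def dimB (C : Type*) [Category* C] : WithBot ℕ∞ := realizationDim (nerve C)

/-! ### Nondegenerate simplices of nerves of categories with a rank function -/

/-! The dimension of a cell of the configuration space, the number of its points on 1-cells, is a
rank function on the face category: a morphism that does not raise it is an identity
(`eq_eqToHom_of_confDim_le`). Hence the ranks strictly increase along a nondegenerate simplex of the
nerve, and its dimension is at most the spread of the ranks (`dimB_le_of_rank`). Ranks are at most
`k`; they are at least `k - min k v(X)`, because points on 0-cells are distinct and so occupy
distinct vertices.

For the rigidity, a lift sends each factor cell to itself or to a cell of larger dimension. If the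
total dimension does not grow, all factor cells agree, and the lift is the identity on the open cell
(`lift_eq_self`), hence on its closure. The order patterns then agree as well (`order_eq_of_lift`).
-/

theorem CategoryTheory.Functor.ext_of_natTrans {C D : Type*} [Category* C] [Category* D]
    {F G : C ⥤ D} (α : F ⟶ G) (hobj : ∀ X, F.obj X = G.obj X)
    (happ : ∀ X, α.app X = eqToHom (hobj X)) : F = G := by
  refine CategoryTheory.Functor.ext hobj fun X Y f => ?_
  have h := α.naturality f
  rw [happ, happ] at h
  rw [← Category.assoc, ← h]
  simp

open scoped Simplicial in
-- Deleting the source of an identity arrow and then repeating its target gives the same chain back.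
theorem mem_nerve_degenerate_of_map_eq {C : Type*} [Category* C] {n : ℕ}
    (s : ComposableArrows C (n + 1)) (i : Fin (n + 1)) (h : s.obj i.castSucc = s.obj i.succ)
    (hm : s.map (homOfLE i.castSucc_lt_succ.le) = eqToHom h) :
    s ∈ (nerve C).degenerate (n + 1) := by
  let t : ComposableArrows C (n + 1) := (nerve C).σ i ((nerve C).δ i.castSucc s)
  suffices hts : t = s from hts ▸ (nerve C).σ_mem_degenerate i ((nerve C).δ i.castSucc s)
  have hθ : ∀ j : Fin (n + 2), j ≠ i.castSucc → i.castSucc.succAbove (i.predAbove j) = j := by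
    intro j hj
    exact Fin.succAbove_predAbove hj
  have hθ' : i.castSucc.succAbove (i.predAbove i.castSucc) = i.succ := by
    simp
  have hle : ∀ j : Fin (n + 2), j ≤ i.castSucc.succAbove (i.predAbove j) := by
    intro j
    by_cases hj : j = i.castSucc
    · subst hj
      rw [hθ']
      exact i.castSucc_lt_succ.le
    · rw [hθ j hj]
  -- The arrows of `s` itself give a transformation to `t`; each component is an identity or the
  -- arrow assumed trivial.
  let α : s ⟶ t :=
    { app := fun j => s.map (homOfLE (hle j))
      naturality := fun j l f => by
        exact (s.map_comp _ _).symm.trans (s.map_comp (homOfLE (hle j)) _) }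
  have key : ∀ j l : Fin (n + 2), ∀ hjl : j ≤ l, (l = j ∨ j = i.castSucc ∧ l = i.succ) →
      ∃ e : s.obj j = s.obj l, s.map (homOfLE hjl) = eqToHom e := by
    rintro j l hjl (rfl | ⟨rfl, rfl⟩)
    · exact ⟨rfl, s.map_id l⟩
    · exact ⟨h, hm⟩
  have key' : ∀ j, ∃ e : s.obj j = t.obj j, α.app j = eqToHom e := by
    intro j
    refine key j _ (hle j) ?_
    by_cases hj : j = i.castSucc
    · subst hj
      exact Or.inr ⟨rfl, hθ'⟩
    · exact Or.inl (hθ j hj)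
  exact (Functor.ext_of_natTrans α (fun j => (key' j).choose)
    fun j => (key' j).choose_spec).symm

theorem strictMono_rank_of_mem_nonDegenerate {C : Type*} [Category* C] (r : C → ℕ)
    (hr : ∀ (a b : C) (f : a ⟶ b), r b ≤ r a → ∃ h : a = b, f = eqToHom h) {n : ℕ}
    (s : ComposableArrows C n) (hs : s ∈ (nerve C).nonDegenerate n) :
    StrictMono fun i => r (s.obj i) := by
  obtain _ | n := n
  · exact fun i j hij => absurd hij (by omega)
  · rw [Fin.strictMono_iff_lt_succ]
    intro i
    by_contra! hlt
    obtain ⟨h, hm⟩ := hr _ _ (s.map (homOfLE i.castSucc_lt_succ.le)) hlt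
    exact hs (mem_nerve_degenerate_of_map_eq s i h hm)

theorem dimB_le_of_rank {C : Type*} [Category* C] (r : C → ℕ)
    (hr : ∀ (a b : C) (f : a ⟶ b), r b ≤ r a → ∃ h : a = b, f = eqToHom h) (m : ℕ)
    (hm : ∀ a b : C, r b ≤ r a + m) : dimB C ≤ ((m : ℕ∞) : WithBot ℕ∞) := by
  refine iSup₂_le fun n hn => ?_
  obtain ⟨_, s, hs, -⟩ := hn
  have hmono := strictMono_rank_of_mem_nonDegenerate r hr s hs
  have hgrow : ∀ i : Fin (n + 1), r (ComposableArrows.obj' s 0) + i ≤ r (s.obj i) := by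
    intro i
    induction i using Fin.induction with
    | zero => exact le_rfl
    | succ i ih =>
      have := hmono i.castSucc_lt_succ
      simp only [Fin.val_succ, Fin.val_castSucc] at ih this ⊢
      omega
  have h1 := hgrow (Fin.last n)
  have h2 := hm (ComposableArrows.obj' s 0) (s.obj (Fin.last n))
  rw [Fin.val_last] at h1
  have : n ≤ m := by omega
  exact_mod_cast this

namespace CellularStratification

/-! ### Characteristic maps and coordinates -/

section

variable {X : Type*} [TopologicalSpace X] {P : Type*} [PartialOrder P]
  (S : CellularStratification X P)

theorem strat_char_of_mem_ball {l : P} {d : S.domain l} (hd : d.1 ∈ Metric.ball 0 1) :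
    S.strat (S.char l d) = l := by
  have : S.char l d ∈ S.strat ⁻¹' {l} := by
    rw [← S.image_ball]
    exact ⟨d, hd, rfl⟩
  exact this

/-- Boundary points of a domain are not mapped into the open cell. -/
theorem mem_ball_of_strat_char {l : P} {d : S.domain l} (hd : S.strat (S.char l d) = l) :
    d.1 ∈ Metric.ball 0 1 := by
  have hd' : S.char l d ∈ S.char l '' {d | d.1 ∈ Metric.ball 0 1} := by
    rw [S.image_ball]
    exact hd
  obtain ⟨d', hd'b, hd'e⟩ := hd'
  -- Approach `d` radially from the open disk. The images tend to the image of `d'`, so by the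
  -- embedding the points also tend to `d'`, and `d = d'`.
  let u : ℕ → EuclideanSpace ℝ (Fin (S.dim l)) := fun n => (1 - 1 / ((n : ℝ) + 1)) • d.1
  have hlim : Filter.Tendsto u Filter.atTop (𝓝 d.1) := by
    have := (tendsto_one_div_add_atTop_nhds_zero_nat (𝕜 := ℝ)).const_sub 1
    simpa [u] using this.smul_const d.1
  have hub : ∀ n, u n ∈ Metric.ball (0 : EuclideanSpace ℝ (Fin (S.dim l))) 1 := by
    intro n
    have h1 : ‖d.1‖ ≤ 1 := by simpa using S.domain_subset l d.2
    have h2 : 0 < 1 / ((n : ℝ) + 1) := by positivity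
    have h3 : 1 / ((n : ℝ) + 1) ≤ 1 := by
      rw [div_le_one (by positivity)]
      linarith [(Nat.cast_nonneg n : (0 : ℝ) ≤ n)]
    rw [mem_ball_zero_iff, norm_smul, Real.norm_of_nonneg (by linarith)]
    nlinarith [norm_nonneg d.1]
  let w : ℕ → {d : S.domain l | d.1 ∈ Metric.ball 0 1} :=
    fun n => ⟨⟨u n, S.ball_subset l (hub n)⟩, hub n⟩
  have hw : Filter.Tendsto (fun n => (w n).1) Filter.atTop (𝓝 d) :=
    tendsto_subtype_rng.2 hlim
  have hw' : Filter.Tendsto w Filter.atTop (𝓝 ⟨d', hd'b⟩) := by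
    rw [(S.isEmbedding_ball l).tendsto_nhds_iff]
    have := ((S.char l).continuous.tendsto d).comp hw
    rw [← hd'e] at this
    exact this
  have hw'' : Filter.Tendsto (fun n => (w n).1) Filter.atTop (𝓝 d') :=
    (continuous_subtype_val.tendsto _).comp hw'
  rw [tendsto_nhds_unique hw hw'']
  exact hd'b

theorem char_injOn_ball (l : P) : Set.InjOn (S.char l) {d | d.1 ∈ Metric.ball 0 1} := by
  intro d hd d' hd' h
  have := (S.isEmbedding_ball l).injective (a₁ := ⟨d, hd⟩) (a₂ := ⟨d', hd'⟩) h
  exact congrArg Subtype.val this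

theorem position_char {l : P} {d : S.domain l} (hd : d.1 ∈ Metric.ball 0 1) :
    S.position (S.char l d) = ∑ i, d.1 i := by
  -- The cell is generalized because `coord` lives in a domain that equals that of `l` only
  -- propositionally.
  have key : ∀ m (e : S.domain m), m = l → e.1 ∈ Metric.ball 0 1 → S.char m e = S.char l d →
      ∑ i, e.1 i = ∑ i, d.1 i := by
    rintro m e rfl he h
    rw [S.char_injOn_ball m he hd h]
  exact key _ _ (S.strat_char_of_mem_ball hd) (S.coord_spec _).1 (S.coord_spec _).2

theorem eq_or_dim_lt_of_mem_closure {x : X} {l : P} (hx : x ∈ closure (S.strat ⁻¹' {l})) :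
    S.strat x = l ∨ S.dim (S.strat x) < S.dim l := by
  by_cases h : S.strat x = l
  · exact Or.inl h
  · obtain ⟨F, -, hF, hcov⟩ := S.boundary l
    obtain ⟨m, hm, hxm⟩ := Set.mem_iUnion₂.1 (hcov ⟨hx, h⟩)
    rw [← (hxm : S.strat x = m)] at hm
    exact Or.inr (hF _ hm)

theorem char_mem_closure {l : P} (d : S.domain l) : S.char l d ∈ closure (S.strat ⁻¹' {l}) := by
  rw [← S.range_char]
  exact Set.mem_range_self d

theorem eq_of_strat_eq_of_dim_eq_zero {x y : X} (h : S.strat x = S.strat y)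
    (h0 : S.dim (S.strat x) = 0) : x = y := by
  have key : ∀ m (e : S.domain m), m = S.strat x → S.char m e = S.char _ (S.coord x) := by
    rintro m e rfl
    have : IsEmpty (Fin (S.dim (S.strat x))) := by rw [h0]; infer_instance
    exact congrArg _ (Subtype.ext (Subsingleton.elim _ _))
  rw [← (S.coord_spec x).2, ← (S.coord_spec y).2]
  exact (key _ _ h.symm).symm

theorem eq_of_sum_eq_of_dim_le_one {l : P} (hl : S.dim l ≤ 1) {d e : S.domain l}
    (h : ∑ i, d.1 i = ∑ i, e.1 i) : d = e := by
  have : Subsingleton (Fin (S.dim l)) := Fin.subsingleton_iff_le_one.2 hl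
  refine Subtype.ext (PiLp.ext fun i => ?_)
  rwa [Fintype.sum_subsingleton _ i, Fintype.sum_subsingleton _ i] at h

/-! ### Morphisms of the face category of a configuration space -/

variable {S} {k : ℕ}

theorem order_eq_zero_of_ne (p : S.ConfCell k) {i j : Fin k} (h : p.1.1 i ≠ p.1.1 j) :
    p.1.2 i j = 0 := by
  obtain ⟨_, x, rfl⟩ := p
  exact if_neg h

theorem order_eq_sign {p : S.ConfCell k} {d : ∀ i, S.domain (p.1.1 i)} (hd : d ∈ S.confInterior p)
    {i j : Fin k} (h : p.1.1 i = p.1.1 j) :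
    p.1.2 i j = SignType.sign (∑ a, (d i).1 a - ∑ a, (d j).1 a) := by
  obtain ⟨hb, x, hx, hp⟩ := hd
  have h1 : S.strat (x.1 i) = S.strat (x.1 j) := by
    rw [← hp] at h
    exact h
  have h2 : p.1.2 i j = SignType.sign (S.position (x.1 i) - S.position (x.1 j)) := by
    rw [← hp]
    exact if_pos h1
  have h3 : ∀ l, S.position (x.1 l) = ∑ a, (d l).1 a := by
    intro l
    rw [hx]
    exact S.position_char (hb l)
  rw [h2, h3, h3]

theorem confInterior_nonempty (p : S.ConfCell k) : (S.confInterior p).Nonempty := by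
  obtain ⟨_, x, rfl⟩ := p
  refine ⟨fun i => S.coord (x.1 i), fun i => (S.coord_spec _).1, x, ?_, rfl⟩
  funext i
  exact (S.coord_spec _).2.symm

theorem confInterior_subset_confDomain (p : S.ConfCell k) : S.confInterior p ⊆ S.confDomain p := by
  rintro d hd
  refine ⟨subset_closure hd, ?_⟩
  obtain ⟨-, x, hx, -⟩ := hd
  rw [← hx]
  exact x.2

/-- The dimension of a cell of the configuration space. -/
def confDim (p : S.ConfCell k) : ℕ := ∑ i, S.dim (p.1.1 i)

theorem lift_apply {p q : FaceCat (S.confFamily k)} (b : p ⟶ q) (d : S.confDomain p.cell) (i : Fin k) :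
    S.char (q.cell.1.1 i) ((b.1 d).1 i) = S.char (p.cell.1.1 i) (d.1 i) :=
  congrFun (congrArg Subtype.val (DFunLike.congr_fun b.2 d)) i

theorem face_eq_or_dim_lt {p q : FaceCat (S.confFamily k)} (b : p ⟶ q) (i : Fin k) :
    p.cell.1.1 i = q.cell.1.1 i ∨ S.dim (p.cell.1.1 i) < S.dim (q.cell.1.1 i) := by
  obtain ⟨d, hd⟩ := confInterior_nonempty p.cell
  have h := lift_apply b ⟨d, confInterior_subset_confDomain _ hd⟩ i
  have h' := S.char_mem_closure ((b.1 ⟨d, confInterior_subset_confDomain _ hd⟩).1 i)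
  rw [h] at h'
  have := S.eq_or_dim_lt_of_mem_closure h'
  rwa [S.strat_char_of_mem_ball (hd.1 i)] at this

theorem cells_eq_of_confDim_le {p q : FaceCat (S.confFamily k)} (b : p ⟶ q)
    (h : confDim q.cell ≤ confDim p.cell) : p.cell.1.1 = q.cell.1.1 := by
  by_contra hne
  obtain ⟨i, hi⟩ := Function.ne_iff.1 hne
  refine h.not_gt (Finset.sum_lt_sum (fun j _ => ?_) ⟨i, Finset.mem_univ i, ?_⟩)
  · rcases face_eq_or_dim_lt b j with h | h
    · rw [h]
    · exact h.le
  · exact (face_eq_or_dim_lt b i).resolve_left hi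

/-- On the open cell the lift cannot use boundary points of the disks, and the characteristic maps
are injective on open disks. The open cell is dense in the domain. -/
theorem lift_eq_self {c : Fin k → P} {σ τ : Fin k → Fin k → SignType}
    {hp : (c, σ) ∈ Set.range (S.confStrat k)} {hq : (c, τ) ∈ Set.range (S.confStrat k)}
    (b : (FaceCat.mk ⟨(c, σ), hp⟩ : FaceCat (S.confFamily k)) ⟶ FaceCat.mk ⟨(c, τ), hq⟩)
    (d : S.confDomain ⟨(c, σ), hp⟩) : (b.1 d).1 = d.1 := by
  let E : Set (S.confDomain ⟨(c, σ), hp⟩) := {d | d.1 ∈ S.confInterior ⟨(c, σ), hp⟩}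
  have hclosed : IsClosed {d : S.confDomain ⟨(c, σ), hp⟩ | (b.1 d).1 = d.1} :=
    isClosed_eq (continuous_subtype_val.comp b.1.continuous) continuous_subtype_val
  have hE : E ⊆ {d | (b.1 d).1 = d.1} := by
    intro d hd
    funext i
    have hdi : (d.1 i).1 ∈ Metric.ball 0 1 := hd.1 i
    have h : S.char (c i) ((b.1 d).1 i) = S.char (c i) (d.1 i) := lift_apply b d i
    refine S.char_injOn_ball (c i) (S.mem_ball_of_strat_char ?_) hdi h
    rw [h]
    exact S.strat_char_of_mem_ball hdi
  have hd : d ∈ closure E := by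
    rw [closure_subtype]
    refine closure_mono ?_ d.2.1
    exact fun e he => ⟨⟨e, confInterior_subset_confDomain _ he⟩, he, rfl⟩
  exact closure_minimal hE hclosed hd

/-- An interior point of the source lies in the closure of the open cell of the target, and its
nonzero coordinate differences keep their signs nearby. -/
theorem order_eq_of_lift (hS : S.IsGraph) {c : Fin k → P} {σ τ : Fin k → Fin k → SignType}
    {hp : (c, σ) ∈ Set.range (S.confStrat k)} {hq : (c, τ) ∈ Set.range (S.confStrat k)}
    (b : (FaceCat.mk ⟨(c, σ), hp⟩ : FaceCat (S.confFamily k)) ⟶ FaceCat.mk ⟨(c, τ), hq⟩) :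
    σ = τ := by
  obtain ⟨d, hd⟩ := confInterior_nonempty (⟨(c, σ), hp⟩ : S.ConfCell k)
  have hdD := confInterior_subset_confDomain _ hd
  have hdq : d ∈ S.confDomain ⟨(c, τ), hq⟩ := by
    have := (b.1 ⟨d, hdD⟩).2
    rw [lift_eq_self b] at this
    exact this
  funext i j
  by_cases hij : c i = c j
  · let f : (∀ i, S.domain (c i)) → ℝ := fun e => ∑ a, (e i).1 a - ∑ a, (e j).1 a
    have hf : Continuous f := by fun_prop
    have hσ : σ i j = SignType.sign (f d) := order_eq_sign hd hij
    have hτ : ∀ e ∈ S.confInterior ⟨(c, τ), hq⟩, τ i j = SignType.sign (f e) :=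
      fun e he => order_eq_sign he hij
    by_cases h0 : f d = 0
    -- In dimension at most one the coordinate determines the point, so a zero difference forces `i
    -- = j`.
    · have hsum : ∀ l (e : S.domain l), l = c j → ∑ a, e.1 a = ∑ a, (d j).1 a →
          S.char l e = S.char (c j) (d j) := by
        rintro _ e rfl h
        rw [S.eq_of_sum_eq_of_dim_le_one (hS _) h]
      have : i = j := hdD.2 (hsum _ (d i) hij (sub_eq_zero.1 h0))
      subst this
      obtain ⟨e, he⟩ := confInterior_nonempty (⟨(c, τ), hq⟩ : S.ConfCell k)
      rw [hσ, hτ e he]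
      simp [f]
    · have hev : ∀ᶠ e in 𝓝 d, SignType.sign (f e) = SignType.sign (f d) :=
        ((continuousAt_sign_of_ne_zero h0).comp hf.continuousAt).eventually
          ((isOpen_discrete {SignType.sign (f d)}).mem_nhds rfl)
      obtain ⟨e, he, heE⟩ := mem_closure_iff_nhds.1 hdq.1 _ hev
      rw [hσ, hτ e heE]
      exact he.symm
  · exact (order_eq_zero_of_ne (⟨(c, σ), hp⟩ : S.ConfCell k) hij).trans
      (order_eq_zero_of_ne (⟨(c, τ), hq⟩ : S.ConfCell k) hij).symm

theorem eq_eqToHom_of_confDim_le (hS : S.IsGraph) {p q : FaceCat (S.confFamily k)} (b : p ⟶ q)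
    (h : confDim q.cell ≤ confDim p.cell) : ∃ e : p = q, b = eqToHom e := by
  have hc := cells_eq_of_confDim_le b h
  obtain ⟨⟨⟨c, σ⟩, hp⟩⟩ := p
  obtain ⟨⟨⟨c', τ⟩, hq⟩⟩ := q
  obtain rfl : c = c' := hc
  obtain rfl := order_eq_of_lift hS b
  exact ⟨rfl, Subtype.ext (ContinuousMap.ext fun d => Subtype.ext (lift_eq_self b d))⟩

/-! ### Bounds on the dimension of a cell -/

theorem confDim_le (hS : S.IsGraph) (p : S.ConfCell k) : confDim p ≤ k := by
  simpa [confDim] using Finset.sum_le_card_nsmul Finset.univ (fun i => S.dim (p.1.1 i)) 1 fun i _ => hS _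

theorem le_confDim_add [Finite P] (p : S.ConfCell k) :
    k ≤ confDim p + min k S.numVertices := by
  classical
  obtain ⟨_, x, rfl⟩ := p
  let Z := {i : Fin k // S.dim (S.strat (x.1 i)) = 0}
  have hZk : Nat.card Z ≤ k := by
    simpa using Nat.card_le_card_of_injective (Subtype.val : Z → Fin k) Subtype.val_injective
  have hZv : Nat.card Z ≤ S.numVertices := by
    -- Finiteness of `P` matters here: `Nat.card` of an infinite set of vertices would be `0`.
    refine Nat.card_le_card_of_injective
      (fun i : Z => (⟨S.strat (x.1 i.1), i.2⟩ : {l : P // S.dim l = 0})) fun i j hij => ?_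
    exact Subtype.ext (x.2 (S.eq_of_strat_eq_of_dim_eq_zero (congrArg Subtype.val hij) i.2))
  have hsum : k ≤ ∑ i, S.dim (S.strat (x.1 i)) + Nat.card Z := by
    have h1 : Nat.card Z = ∑ i, if S.dim (S.strat (x.1 i)) = 0 then 1 else 0 := by
      rw [Nat.card_eq_fintype_card, Fintype.card_subtype, Finset.card_filter]
    rw [h1, ← Finset.sum_add_distrib]
    have := Finset.card_nsmul_le_sum Finset.univ (fun i => S.dim (S.strat (x.1 i)) +
      if S.dim (S.strat (x.1 i)) = 0 then 1 else 0) 1 fun i _ => by split_ifs <;> omega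
    simpa using this
  exact hsum.trans (Nat.add_le_add_left (le_min hZk hZv) _)

end

end CellularStratification

theorem mainTheorem3 {X : Type*} [TopologicalSpace X] [T2Space X] [ConnectedSpace X]
    {P : Type*} [PartialOrder P] [Finite P] (S : CellularStratification X P) (hS : S.IsGraph)
    (k : ℕ) :
    dimB (FaceCat (S.confFamily k)) ≤ ((min k S.numVertices : ℕ) : WithBot ℕ∞) :=
  dimB_le_of_rank (fun p => CellularStratification.confDim p.cell)
    (fun _ _ b h => CellularStratification.eq_eqToHom_of_confDim_le hS b h) _
    fun p q => (CellularStratification.confDim_le hS q.cell).trans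
      (CellularStratification.le_confDim_add p.cell)
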